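/- Let $M$ be a smooth (Hausdorff, second countable, finite-dimensional, boundaryless) manifold, let $h$ be a smooth Riemannian metric on $M$, and let $g$ be a continuous, time-oriented Lorentzian metric on $M$ of signature $(-,+,\dots,+)$; causal vectors are by convention non-zero. A future-directed $g$-causal curve is a locally Lipschitz curve $\gamma\colon J\to M$, $J\subset\mathbb R$ an interval, whose velocity is a future-directed $g$-causal vector almost everywhere; it is $h$-parametrised if it is parametrised by $h$-arc length. For continuous time-oriented Lorentzian metrics write $\hat g\succ g$ if at every point of $M$ the future causal cone of $g$ is contained in the future timelike cone of $\hat g$. The metric $g$ is causal if there is no closed $g$-causal curve, and stably causal if there is a causal metric $\hat g\succ g$. A time function for $g$ is a continuous function $M\to\mathbb R$ that is strictly increasing along every future-directed $g$-causal curve. A function $\tau\colon M\to\mathbb R$ is locally $g$-anti-Lipschitz if every $p\in M$ has a relatively compact neighbourhood $\mathcal O_p$ and a constant $C_p>0$ such that $$\tau(\gamma(s_2))-\tau(\gamma(s_1))\ \ge\ C_p\,(s_2-s_1)\qquad\text{for all } s_2\ge s_1$$ for every $h$-parametrised future-directed $g$-causal curve $\gamma$ with image in $\mathcal O_p$ (this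 property does not depend on the choice of $h$). **Theorem.** Suppose that $(M,g)$ is stably causal and let $\tau$ be a time function on $M$ that is locally Lipschitz (in local coordinates) and locally $g$-anti-Lipschitz. Then there exists a continuous time-oriented Lorentzian metric $\hat g\succ g$ on $M$ such that $\tau$ is locally $\hat g$-anti-Lipschitz. -/

import Mathlib

open scoped Manifold ContDiff Topology
open Set

/-- A continuous Lorentzian metric of signature `(-,+,…,+)` on a manifold `M` modelled on `E`. -/
structure LorentzianMetric (E : Type*) [NormedAddCommGroup E] [NormedSpace ℝ E]
    (M : Type*) [TopologicalSpace M] [ChartedSpace E M] [IsManifold 𝓘(ℝ, E) ∞ M] where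
  /-- The bilinear form on each tangent space. -/
  inner (x : M) : TangentSpace 𝓘(ℝ, E) x →L[ℝ] TangentSpace 𝓘(ℝ, E) x →L[ℝ] ℝ
  symm (x : M) (v w : TangentSpace 𝓘(ℝ, E) x) : inner x v w = inner x w v
  /-- Signature `(-,+,…,+)`: some vector is negative, and the form is positive definite on its
  orthogonal complement. -/
  signature (x : M) : ∃ v : TangentSpace 𝓘(ℝ, E) x, inner x v v < 0 ∧
    ∀ w : TangentSpace 𝓘(ℝ, E) x, w ≠ 0 → inner x v w = 0 → 0 < inner x w w
  continuous_inner : Continuous fun x : M ↦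
    (Bundle.TotalSpace.mk' (E →L[ℝ] E →L[ℝ] ℝ) x (inner x) :
      Bundle.TotalSpace (E →L[ℝ] E →L[ℝ] ℝ) fun x : M ↦
        TangentSpace 𝓘(ℝ, E) x →L[ℝ] TangentSpace 𝓘(ℝ, E) x →L[ℝ] ℝ)

/-- A time-oriented continuous Lorentzian metric: the time orientation is given by a continuous
timelike vector field, declared to be future-directed. -/
structure SpacetimeMetric (E : Type*) [NormedAddCommGroup E] [NormedSpace ℝ E]
    (M : Type*) [TopologicalSpace M] [ChartedSpace E M] [IsManifold 𝓘(ℝ, E) ∞ M]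
    extends LorentzianMetric E M where
  /-- The future-directed timelike vector field. -/
  timeField (x : M) : TangentSpace 𝓘(ℝ, E) x
  timeField_timelike (x : M) : inner x (timeField x) (timeField x) < 0
  continuous_timeField : Continuous fun x : M ↦ (⟨x, timeField x⟩ : TangentBundle 𝓘(ℝ, E) M)

section

variable {E : Type*} [NormedAddCommGroup E] [NormedSpace ℝ E]
  {M : Type*} [TopologicalSpace M] [ChartedSpace E M]

/-- The velocity `γ'(s)` of a curve; it is `0` at points of non-differentiability. -/
noncomputable def curveVelocity (E : Type*) [NormedAddCommGroup E] [NormedSpace ℝ E]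
    {M : Type*} [TopologicalSpace M] [ChartedSpace E M] (γ : ℝ → M) (s : ℝ) :
    TangentSpace 𝓘(ℝ, E) (γ s) :=
  mfderiv 𝓘(ℝ, ℝ) 𝓘(ℝ, E) γ s (1 : ℝ)

/-- The curve `γ` restricted to `J` is locally Lipschitz, in local coordinates. -/
def IsLocallyLipschitzCurveOn (E : Type*) [NormedAddCommGroup E] [NormedSpace ℝ E]
    {M : Type*} [TopologicalSpace M] [ChartedSpace E M] (γ : ℝ → M) (J : Set ℝ) : Prop :=
  ContinuousOn γ J ∧ ∀ s ∈ J, ∃ K : NNReal, ∃ V ∈ 𝓝[J] s,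
    LipschitzOnWith K (fun t ↦ extChartAt 𝓘(ℝ, E) (γ s) (γ t)) V

/-- A real function on `M` is locally Lipschitz, in local coordinates. -/
def IsLocallyLipschitzFun (E : Type*) [NormedAddCommGroup E] [NormedSpace ℝ E]
    {M : Type*} [TopologicalSpace M] [ChartedSpace E M] (τ : M → ℝ) : Prop :=
  ∀ p : M, ∃ K : NNReal, ∃ V ∈ 𝓝 (extChartAt 𝓘(ℝ, E) p p),
    LipschitzOnWith K (fun y ↦ τ ((extChartAt 𝓘(ℝ, E) p).symm y)) V

variable [IsManifold 𝓘(ℝ, E) ∞ M]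

/-- `v` is a future-directed causal vector (causal vectors are non-zero). -/
def SpacetimeMetric.IsFutureCausal (g : SpacetimeMetric E M) {x : M}
    (v : TangentSpace 𝓘(ℝ, E) x) : Prop :=
  v ≠ 0 ∧ g.inner x v v ≤ 0 ∧ g.inner x v (g.timeField x) < 0

/-- `v` is a future-directed timelike vector. -/
def SpacetimeMetric.IsFutureTimelike (g : SpacetimeMetric E M) {x : M}
    (v : TangentSpace 𝓘(ℝ, E) x) : Prop :=
  g.inner x v v < 0 ∧ g.inner x v (g.timeField x) < 0

/-- `g ≺ g'`: at every point the future causal cone of `g` is contained in the future timelike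
cone of `g'` (and hence likewise for the past cones). -/
def SpacetimeMetric.Prec (g g' : SpacetimeMetric E M) : Prop :=
  ∀ (x : M) (v : TangentSpace 𝓘(ℝ, E) x), g.IsFutureCausal v → g'.IsFutureTimelike v

/-- `γ` restricted to the interval `J` is a future-directed causal curve: it is locally Lipschitz,
and almost everywhere differentiable with future-directed causal velocity. -/
def SpacetimeMetric.IsFutureCausalCurveOn (g : SpacetimeMetric E M) (γ : ℝ → M)
    (J : Set ℝ) : Prop :=
  J.OrdConnected ∧ IsLocallyLipschitzCurveOn E γ J ∧
    ∀ᵐ s : ℝ, s ∈ J → MDifferentiableAt 𝓘(ℝ, ℝ) 𝓘(ℝ, E) γ s ∧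
      g.IsFutureCausal (curveVelocity E γ s)

/-- A metric is causal if there are no closed causal curves. -/
def SpacetimeMetric.IsCausal (g : SpacetimeMetric E M) : Prop :=
  ¬ ∃ (γ : ℝ → M) (a b : ℝ), a < b ∧ g.IsFutureCausalCurveOn γ (Icc a b) ∧ γ a = γ b

/-- A metric is stably causal if some metric with wider cones is causal. -/
def SpacetimeMetric.IsStablyCausal (g : SpacetimeMetric E M) : Prop :=
  ∃ g' : SpacetimeMetric E M, g.Prec g' ∧ g'.IsCausal

/-- A time function: continuous and strictly increasing along every future-directed causal
curve. -/
def SpacetimeMetric.IsTimeFunction (g : SpacetimeMetric E M) (τ : M → ℝ) : Prop :=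
  Continuous τ ∧ ∀ (γ : ℝ → M) (J : Set ℝ), g.IsFutureCausalCurveOn γ J →
    StrictMonoOn (fun s ↦ τ (γ s)) J

/-- A locally Lipschitz curve is parametrised by `h`-arc length on `J`, i.e. it has unit `h`-speed
almost everywhere. -/
def IsArcLengthParametrisedOn
    (h : Bundle.ContMDiffRiemannianMetric 𝓘(ℝ, E) ∞ E fun x : M ↦ TangentSpace 𝓘(ℝ, E) x)
    (γ : ℝ → M) (J : Set ℝ) : Prop :=
  ∀ᵐ s : ℝ, s ∈ J → h.inner (γ s) (curveVelocity E γ s) (curveVelocity E γ s) = 1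

/-- `τ` is locally `g`-anti-Lipschitz, with arc length measured by the Riemannian metric `h`. -/
def SpacetimeMetric.IsLocallyAntiLipschitz (g : SpacetimeMetric E M)
    (h : Bundle.ContMDiffRiemannianMetric 𝓘(ℝ, E) ∞ E fun x : M ↦ TangentSpace 𝓘(ℝ, E) x)
    (τ : M → ℝ) : Prop :=
  ∀ p : M, ∃ U ∈ 𝓝 p, IsCompact (closure U) ∧ ∃ C : ℝ, 0 < C ∧
    ∀ (γ : ℝ → M) (J : Set ℝ), g.IsFutureCausalCurveOn γ J → IsArcLengthParametrisedOn h γ J →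
      MapsTo γ J U → ∀ s₁ ∈ J, ∀ s₂ ∈ J, s₁ ≤ s₂ → C * (s₂ - s₁) ≤ τ (γ s₂) - τ (γ s₁)

end

/-! The Lipschitz bound pays for tilting a direction slightly, and the anti-Lipschitz bound leaves
room for that payment. Near `p`, work in a chart, let `T₀` be the coordinate vector of the time
field at `p`, and let `v` be a chart-unit vector of a slightly wider cone. For a small fixed `δ`,
compactness of the unit sphere makes `w = v + δ T₀` `g`-timelike at all nearby points at once
(`exists_nhds_timelike_of_add`). The chart segment in direction `w` is then a `g`-causal curve, so
`τ` grows along it at a definite rate (`mul_le_sub_of_chart_segment`). Moving the endpoint from `y +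
u w` to `y + u v` costs at most `K u δ ‖T₀‖`, which for small `δ` is at most half of the gain. Hence
`τ` also grows linearly in direction `v` (`exists_chart_growth`).

Along a curve that is causal for the wider cone, `τ ∘ γ` is locally Lipschitz. Wherever it and `γ`
are differentiable, its derivative is controlled by the increments of `τ` along the straight line
with the same velocity, because `τ` is Lipschitz. Integrating the resulting bound gives
`exists_nhds_wider`, with a cone width `e` depending on `p`.

To globalise, take `g - ε g(T, ·)²` with a continuous `ε > 0` that lies pointwise below some local
width; such an `ε` exists because the admissible values form intervals. -/

/-! ### One-variable calculus -/

open MeasureTheory in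
/-- A lower bound for the derivative of a locally Lipschitz function almost everywhere gives a
lower bound for its increments. -/
lemma LocallyLipschitzOn.mul_sub_le_of_ae_le_deriv {f : ℝ → ℝ} {a b k : ℝ} (hab : a ≤ b)
    (hf : LocallyLipschitzOn (Icc a b) f)
    (hd : ∀ᵐ s : ℝ, s ∈ Icc a b → DifferentiableAt ℝ f s → k ≤ deriv f s) :
    k * (b - a) ≤ f b - f a := by
  obtain ⟨K, hK⟩ := hf.exists_lipschitzOnWith_of_compact isCompact_Icc
  rw [← uIcc_of_le hab] at hK
  have hac := hK.absolutelyContinuousOnInterval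
  rw [← hac.integral_deriv_eq_sub]
  have hk : ∫ _ in a..b, k = k * (b - a) := by simp [mul_comm]
  rw [← hk]
  refine intervalIntegral.integral_mono_ae_restrict hab intervalIntegrable_const
    hac.intervalIntegrable_deriv ?_
  filter_upwards [ae_restrict_of_ae hd, ae_restrict_of_ae hac.ae_differentiableAt,
    ae_restrict_mem measurableSet_Icc] with s h1 h2 h3
  exact h1 h3 (h2 (by rwa [uIcc_of_le hab]))

open MeasureTheory in
/-- The inverse of the arc length function of a curve of speed `ρ`. -/
lemma exists_arcLength_inverse {ρ : ℝ → ℝ} (hρ : Continuous ρ) {m : ℝ} (hm : 0 < m)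
    (hmρ : ∀ t, m ≤ ρ t) :
    ∃ σ : ℝ → ℝ, StrictMono σ ∧ σ 0 = 0 ∧ (∀ s, HasDerivAt σ (ρ (σ s))⁻¹ s) ∧
      ∀ t, 0 ≤ t → ∃ s, m * t ≤ s ∧ σ s = t := by
  set S : ℝ → ℝ := fun t ↦ ∫ r in (0 : ℝ)..t, ρ r with hS
  have hderiv : ∀ t, HasDerivAt S (ρ t) t := fun t ↦
    intervalIntegral.integral_hasDerivAt_right (hρ.intervalIntegrable _ _)
      (hρ.stronglyMeasurableAtFilter _ _) hρ.continuousAt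
  have hcont : Continuous S := continuous_iff_continuousAt.2 fun t ↦ (hderiv t).continuousAt
  -- This bound makes `S` strictly increasing and unbounded both ways, so its inverse lives on all
  -- of `ℝ`, and it also gives the length estimate `m * t ≤ S t`.
  have hgrow : ∀ a b, a ≤ b → m * (b - a) ≤ S b - S a := fun a b hab ↦ by
    refine Convex.mul_sub_le_image_sub_of_le_deriv convex_univ hcont.continuousOn
      (fun t _ ↦ (hderiv t).differentiableAt.differentiableWithinAt)
      (fun t _ ↦ ?_) a (mem_univ _) b (mem_univ _) hab
    rw [(hderiv t).deriv]; exact hmρ t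
  have hmono : StrictMono S := fun a b hab ↦ by
    have := hgrow a b hab.le
    nlinarith [mul_pos hm (sub_pos.2 hab)]
  have h0 : S 0 = 0 := by simp [hS]
  have htop : Filter.Tendsto S Filter.atTop Filter.atTop := by
    refine Filter.tendsto_atTop_mono' _ ?_ (Filter.tendsto_id.const_mul_atTop hm)
    filter_upwards [Filter.eventually_ge_atTop 0] with t ht
    have := hgrow 0 t ht
    simp only [h0, id] at *; linarith
  have hbot : Filter.Tendsto S Filter.atBot Filter.atBot := by
    refine Filter.tendsto_atBot_mono' _ ?_ (Filter.tendsto_id.const_mul_atBot hm)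
    filter_upwards [Filter.eventually_le_atBot 0] with t ht
    have := hgrow t 0 ht
    simp only [h0, id] at *; linarith
  have hsurj : Function.Surjective S := hcont.surjective htop hbot
  let e : ℝ ≃o ℝ := hmono.orderIsoOfSurjective S hsurj
  have heS : ∀ t, e t = S t := fun t ↦ rfl
  have hinv : ∀ s, S (e.symm s) = s := fun s ↦ e.apply_symm_apply s
  have hinv' : ∀ t, e.symm (S t) = t := fun t ↦ e.symm_apply_apply t
  refine ⟨e.symm, e.symm.strictMono, ?_, fun s ↦ ?_, fun t ht ↦ ⟨S t, ?_, hinv' t⟩⟩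
  · rw [← h0, hinv' 0, h0]
  · exact HasDerivAt.of_local_left_inverse e.symm.continuous.continuousAt (hderiv _)
      (hm.trans_le (hmρ _)).ne' (Filter.Eventually.of_forall hinv)
  · have := hgrow 0 t ht
    rw [h0] at this; linarith

/-! ### Chart frames of the tangent bundle -/

section Frames

variable {E : Type*} [NormedAddCommGroup E] [NormedSpace ℝ E]
  {M : Type*} [TopologicalSpace M] [ChartedSpace E M] [IsManifold 𝓘(ℝ, E) ∞ M]

/-- Continuity of the value of a continuous field of bilinear forms on continuous vector fields
along a map. -/
lemma ContinuousWithinAt.bilinForm_apply {N : Type*} [TopologicalSpace N]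
    {b : ∀ x : M, TangentSpace 𝓘(ℝ, E) x →L[ℝ] TangentSpace 𝓘(ℝ, E) x →L[ℝ] ℝ}
    (hb : Continuous fun x : M ↦
      (Bundle.TotalSpace.mk' (E →L[ℝ] E →L[ℝ] ℝ) x (b x) :
        Bundle.TotalSpace (E →L[ℝ] E →L[ℝ] ℝ) fun x : M ↦
          TangentSpace 𝓘(ℝ, E) x →L[ℝ] TangentSpace 𝓘(ℝ, E) x →L[ℝ] ℝ))
    {q : N → M} {v w : ∀ n, TangentSpace 𝓘(ℝ, E) (q n)} {s : Set N} {n : N}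
    (hv : ContinuousWithinAt (fun n ↦ (⟨q n, v n⟩ : TangentBundle 𝓘(ℝ, E) M)) s n)
    (hw : ContinuousWithinAt (fun n ↦ (⟨q n, w n⟩ : TangentBundle 𝓘(ℝ, E) M)) s n) :
    ContinuousWithinAt (fun n ↦ b (q n) (v n) (w n)) s n := by
  have hq : ContinuousWithinAt q s n := by
    simp only [FiberBundle.continuousWithinAt_totalSpace] at hv
    exact hv.1
  have : ContinuousWithinAt (fun n ↦ Bundle.TotalSpace.mk' ℝ (E := Bundle.Trivial M ℝ) (q n)
      (b (q n) (v n) (w n))) s n :=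
    (hb.continuousAt.comp_continuousWithinAt hq).clm_bundle_apply₂ (F₁ := E) (F₂ := E) hv hw
  simp only [FiberBundle.continuousWithinAt_totalSpace] at this
  exact this.2

/-- The identification of `E` with the tangent space at `x` through the chart at `p`. -/
noncomputable def chartFrame (p x : M) : E →L[ℝ] TangentSpace 𝓘(ℝ, E) x :=
  (trivializationAt E (TangentSpace 𝓘(ℝ, E)) p).symmL ℝ x

lemma chartFrame_apply {p x : M} (hx : x ∈ (chartAt E p).source) (v : E) :
    chartFrame p x v = (trivializationAt E (TangentSpace 𝓘(ℝ, E)) p).symm x v :=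
  (trivializationAt E (TangentSpace 𝓘(ℝ, E)) p).symmL_apply (R := ℝ) hx v

lemma continuousOn_chartFrame (p : M) :
    ContinuousOn (fun z : M × E ↦ (⟨z.1, chartFrame p z.1 z.2⟩ : TangentBundle 𝓘(ℝ, E) M))
      ((chartAt E p).source ×ˢ univ) := by
  have h := (trivializationAt E (TangentSpace 𝓘(ℝ, E)) p).continuousOn_symm
  refine h.congr fun z hz ↦ ?_
  rw [chartFrame_apply hz.1]

lemma chartFrame_mfderiv {p x : M} (hx : x ∈ (chartAt E p).source)
    (u : TangentSpace 𝓘(ℝ, E) x) :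
    chartFrame (E := E) p x (mfderiv 𝓘(ℝ, E) 𝓘(ℝ, E) (extChartAt 𝓘(ℝ, E) p) x u) = u := by
  rw [← TangentBundle.continuousLinearMapAt_trivializationAt hx]
  exact (trivializationAt E (TangentSpace 𝓘(ℝ, E)) p).symmL_continuousLinearMapAt hx u

lemma chartFrame_injective {p x : M} (hx : x ∈ (chartAt E p).source) :
    Function.Injective (chartFrame (E := E) p x) := fun v w h ↦ by
  have key := fun v ↦
    (trivializationAt E (TangentSpace 𝓘(ℝ, E)) p).continuousLinearMapAt_symmL (R := ℝ) hx v
  rw [← key v, ← key w]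
  exact congrArg _ h

/-- Used to compute velocities: a curve that is straight in the chart, with direction `w`, has
velocity proportional to the frame image of `w`. -/
lemma hasMFDerivAt_extChartAt_symm_chartFrame (p : M) {y : E}
    (hy : y ∈ (extChartAt 𝓘(ℝ, E) p).target) :
    HasMFDerivAt 𝓘(ℝ, E) 𝓘(ℝ, E) (extChartAt 𝓘(ℝ, E) p).symm y
      (chartFrame (E := E) p ((extChartAt 𝓘(ℝ, E) p).symm y)) := by
  have hx : (extChartAt 𝓘(ℝ, E) p).symm y ∈ (chartAt E p).source := by
    simpa using (extChartAt 𝓘(ℝ, E) p).map_target hy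
  have h := (mdifferentiableWithinAt_extChartAt_symm hy).hasMFDerivWithinAt
  have h2 := TangentBundle.symmL_trivializationAt hx (I := 𝓘(ℝ, E))
  rw [(extChartAt 𝓘(ℝ, E) p).right_inv hy] at h2
  simp only [modelWithCornersSelf_coe, range_id, hasMFDerivWithinAt_univ, mfderivWithin_univ] at h h2
  rw [chartFrame, h2]
  exact h

/-- A field of bilinear forms on a finite-dimensional manifold is continuous if its coefficients in
all chart frames are. -/
lemma continuous_bilinForm_of_chartFrame [FiniteDimensional ℝ E]
    {b : ∀ x : M, TangentSpace 𝓘(ℝ, E) x →L[ℝ] TangentSpace 𝓘(ℝ, E) x →L[ℝ] ℝ}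
    (h : ∀ (p : M) (v w : E), ContinuousAt (fun x ↦ b x (chartFrame p x v) (chartFrame p x w)) p) :
    Continuous fun x : M ↦
      (Bundle.TotalSpace.mk' (E →L[ℝ] E →L[ℝ] ℝ) x (b x) :
        Bundle.TotalSpace (E →L[ℝ] E →L[ℝ] ℝ) fun x : M ↦
          TangentSpace 𝓘(ℝ, E) x →L[ℝ] TangentSpace 𝓘(ℝ, E) x →L[ℝ] ℝ) := by
  refine continuous_iff_continuousAt.2 fun p ↦ ?_
  rw [continuousAt_hom_bundle]
  refine ⟨continuousAt_id, ?_⟩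
  rw [continuousAt_clm_apply]
  intro v
  rw [continuousAt_clm_apply]
  intro w
  refine (h p v w).congr ?_
  filter_upwards [(chartAt E p).open_source.mem_nhds (mem_chart_source E p)] with x hx
  have hx' : x ∈ (trivializationAt E (TangentSpace 𝓘(ℝ, E)) p).baseSet := hx
  have := inCoordinates_apply_eq₂ (ϕ := b x) (v := v) (w := w) hx' hx'
    (E₃ := Bundle.Trivial M ℝ) (F₃ := ℝ) (x₀ := p) (mem_univ _)
  refine Eq.trans ?_ this.symm
  rw [chartFrame_apply hx, chartFrame_apply hx]
  simp

end Frames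

/-! ### Widening the light cones -/

section Widening

variable {E : Type*} [NormedAddCommGroup E] [NormedSpace ℝ E]
  {M : Type*} [TopologicalSpace M] [ChartedSpace E M] [IsManifold 𝓘(ℝ, E) ∞ M]

/-- The orthogonal complement of a timelike vector is positive definite. -/
lemma LorentzianMetric.pos_of_inner_eq_zero (g : LorentzianMetric E M) {x : M}
    {T w : TangentSpace 𝓘(ℝ, E) x} (hT : g.inner x T T < 0) (hw : w ≠ 0)
    (hTw : g.inner x T w = 0) : 0 < g.inner x w w := by
  obtain ⟨v, hv, hpos⟩ := g.signature x
  by_contra! hle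
  have hTv : g.inner x v T ≠ 0 := fun h ↦ by
    have : T ≠ 0 := fun h0 ↦ by simp [h0] at hT
    exact absurd (hpos T this h) (not_lt.2 hT.le)
  have hTw' : g.inner x w T = 0 := by rw [g.symm, hTw]
  set a := g.inner x v T with ha
  set c := g.inner x v w with hc
  -- If `g(w, w) ≤ 0`, the form is nonpositive on the span of `T` and `w`. This combination is a
  -- nonzero vector of that span orthogonal to `v`, where the form must be positive.
  have hne : a • w - c • T ≠ 0 := fun h ↦ by
    have h1 : g.inner x T (a • w - c • T) = 0 := by rw [h, map_zero]
    simp only [map_sub, map_smul, hTw, smul_eq_mul, mul_zero, zero_sub, neg_eq_zero] at h1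
    have hc0 : c = 0 := (mul_eq_zero.1 h1).resolve_right hT.ne
    rw [hc0, zero_smul, sub_zero] at h
    exact (smul_ne_zero hTv hw) h
  have h2 := hpos _ hne (by simp only [map_sub, map_smul, smul_eq_mul, ← ha, ← hc]; ring)
  simp only [map_sub, map_smul, smul_eq_mul, sub_apply,
    smul_apply, hTw, hTw'] at h2
  nlinarith [sq_nonneg a, sq_nonneg c, mul_nonneg (sq_nonneg a) (neg_nonneg.2 hle),
    mul_nonneg (sq_nonneg c) (neg_nonneg.2 hT.le)]

/-- The metric `g - ε g(T, ·)²`, where `T` is the time field of `g`. -/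
noncomputable def SpacetimeMetric.widen [FiniteDimensional ℝ E] (g : SpacetimeMetric E M)
    (ε : M → ℝ) (hε : Continuous ε) (hpos : ∀ x, 0 < ε x) : SpacetimeMetric E M where
  inner x := g.inner x -
    ε x • (g.inner x (g.timeField x)).smulRight (g.inner x (g.timeField x))
  symm x v w := by
    simp only [sub_apply, smul_apply,
      ContinuousLinearMap.smulRight_apply, smul_eq_mul, g.symm x v w]
    ring
  signature x := by
    have hT := g.timeField_timelike x
    refine ⟨g.timeField x, ?_, fun w hw h0 ↦ ?_⟩
    · simp only [sub_apply, smul_apply,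
        ContinuousLinearMap.smulRight_apply, smul_eq_mul]
      nlinarith [mul_nonneg (hpos x).le (mul_self_nonneg (g.inner x (g.timeField x) (g.timeField x)))]
    · simp only [sub_apply, smul_apply,
        ContinuousLinearMap.smulRight_apply, smul_eq_mul] at h0 ⊢
      -- Since `1 - ε g(T, T) > 0`, orthogonality to `T` means the same for both metrics, and the
      -- correction term vanishes on such vectors.
      have h1 : g.inner x (g.timeField x) w = 0 := by
        have h2 : g.inner x (g.timeField x) w *
            (1 - ε x * g.inner x (g.timeField x) (g.timeField x)) = 0 := by linarith
        refine (mul_eq_zero.1 h2).resolve_right (ne_of_gt ?_)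
        nlinarith [mul_pos (hpos x) (neg_pos.2 hT)]
      simpa [h1] using g.pos_of_inner_eq_zero hT hw h1
  continuous_inner := by
    refine continuous_bilinForm_of_chartFrame fun p v w ↦ ?_
    have hT : ContinuousAt (fun x ↦ (⟨x, g.timeField x⟩ : TangentBundle 𝓘(ℝ, E) M)) p :=
      g.continuous_timeField.continuousAt
    have hF : ∀ v : E,
        ContinuousAt (fun x ↦ (⟨x, chartFrame p x v⟩ : TangentBundle 𝓘(ℝ, E) M)) p := fun v ↦
      ((continuousOn_chartFrame p).continuousAt (x := (p, v)) (prod_mem_nhds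
        ((chartAt E p).open_source.mem_nhds (mem_chart_source E p)) Filter.univ_mem)).comp
        (f := fun x ↦ (x, v)) (by fun_prop)
    have key : ∀ {v w : ∀ x : M, TangentSpace 𝓘(ℝ, E) x},
        ContinuousAt (fun x ↦ (⟨x, v x⟩ : TangentBundle 𝓘(ℝ, E) M)) p →
        ContinuousAt (fun x ↦ (⟨x, w x⟩ : TangentBundle 𝓘(ℝ, E) M)) p →
        ContinuousAt (fun x ↦ g.inner x (v x) (w x)) p := fun hv hw ↦ by
      rw [← continuousWithinAt_univ] at *
      exact ContinuousWithinAt.bilinForm_apply g.continuous_inner hv hw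
    exact (key (hF v) (hF w)).sub (hε.continuousAt.mul ((key hT (hF v)).mul (key hT (hF w))))
  timeField := g.timeField
  timeField_timelike x := by
    have hT := g.timeField_timelike x
    simp only [sub_apply, smul_apply,
        ContinuousLinearMap.smulRight_apply, smul_eq_mul]
    nlinarith [mul_nonneg (hpos x).le (mul_self_nonneg (g.inner x (g.timeField x) (g.timeField x)))]
  continuous_timeField := g.continuous_timeField

variable [FiniteDimensional ℝ E] (g : SpacetimeMetric E M)
    {ε : M → ℝ} (hε : Continuous ε) (hpos : ∀ x, 0 < ε x)

lemma SpacetimeMetric.widen_inner (x : M) (v w : TangentSpace 𝓘(ℝ, E) x) :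
    (g.widen ε hε hpos).inner x v w = g.inner x v w -
      ε x * (g.inner x v (g.timeField x) * g.inner x w (g.timeField x)) := by
  rw [g.symm x v (g.timeField x), g.symm x w (g.timeField x)]
  rfl

lemma SpacetimeMetric.widen_inner_timeField (x : M) (v : TangentSpace 𝓘(ℝ, E) x) :
    (g.widen ε hε hpos).inner x v ((g.widen ε hε hpos).timeField x) =
      g.inner x v (g.timeField x) *
        (1 - ε x * g.inner x (g.timeField x) (g.timeField x)) := by
  rw [g.widen_inner]
  change g.inner x v (g.timeField x) - ε x * (g.inner x v (g.timeField x) *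
    g.inner x (g.timeField x) (g.timeField x)) = _
  ring

lemma SpacetimeMetric.widen_inner_timeField_neg_iff (x : M) (v : TangentSpace 𝓘(ℝ, E) x) :
    (g.widen ε hε hpos).inner x v ((g.widen ε hε hpos).timeField x) < 0 ↔
      g.inner x v (g.timeField x) < 0 := by
  rw [g.widen_inner_timeField]
  have : 0 < 1 - ε x * g.inner x (g.timeField x) (g.timeField x) := by
    nlinarith [mul_pos (hpos x) (neg_pos.2 (g.timeField_timelike x))]
  exact ⟨fun h ↦ by by_contra! h'; nlinarith [mul_nonneg h' this.le],
    fun h ↦ mul_neg_of_neg_of_pos h this⟩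

/-- On a future causal vector `g(v, T) ≠ 0`, so subtracting `ε g(v, T)²` makes a nonpositive square
strictly negative. -/
lemma SpacetimeMetric.prec_widen : g.Prec (g.widen ε hε hpos) := by
  rintro x v ⟨-, hv, hvT⟩
  refine ⟨?_, (g.widen_inner_timeField_neg_iff hε hpos x v).2 hvT⟩
  rw [g.widen_inner]
  nlinarith [mul_pos (hpos x) (mul_pos_of_neg_of_neg hvT hvT)]

end Widening

/-! ### Growth along chart segments -/

section ChartLines

variable {E : Type*} [NormedAddCommGroup E] [NormedSpace ℝ E]
  {M : Type*} [TopologicalSpace M] [ChartedSpace E M] [IsManifold 𝓘(ℝ, E) ∞ M]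

omit [IsManifold 𝓘(ℝ, E) ∞ M] in
lemma isLocallyLipschitzCurveOn_of_contMDiffAt {γ : ℝ → M} {J : Set ℝ}
    (hγ : ∀ s ∈ J, ContMDiffAt 𝓘(ℝ, ℝ) 𝓘(ℝ, E) 1 γ s) : IsLocallyLipschitzCurveOn E γ J := by
  refine ⟨fun s hs ↦ (hγ s hs).continuousAt.continuousWithinAt, fun s hs ↦ ?_⟩
  have h1 := (contMDiffAt_iff.1 (hγ s hs)).2
  simp only [modelWithCornersSelf_coe, range_id, contDiffWithinAt_univ, extChartAt_model_space_eq_id,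
    PartialEquiv.refl_symm, PartialEquiv.refl_coe, Function.comp_id, id_eq] at h1
  obtain ⟨K, V, hV, hK⟩ := h1.exists_lipschitzOnWith
  exact ⟨K, V, mem_nhdsWithin_of_mem_nhds hV, hK⟩

/-- The segment in a chart in a direction that is causal all along it, parametrised by arc length,
is a causal curve: an anti-Lipschitz function grows linearly along it. -/
lemma SpacetimeMetric.mul_le_sub_of_chart_segment (g : SpacetimeMetric E M)
    (h : Bundle.ContMDiffRiemannianMetric 𝓘(ℝ, E) ∞ E fun x : M ↦ TangentSpace 𝓘(ℝ, E) x)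
    {τ : M → ℝ} {U : Set M} {C : ℝ} (hC : 0 < C)
    (hU : ∀ (γ : ℝ → M) (J : Set ℝ), g.IsFutureCausalCurveOn γ J → IsArcLengthParametrisedOn h γ J →
      MapsTo γ J U → ∀ s₁ ∈ J, ∀ s₂ ∈ J, s₁ ≤ s₂ → C * (s₂ - s₁) ≤ τ (γ s₂) - τ (γ s₁))
    {p : M} {B : Set E} (hBconv : Convex ℝ B)
    (hBt : B ⊆ (extChartAt 𝓘(ℝ, E) p).target)
    (hBU : MapsTo (extChartAt 𝓘(ℝ, E) p).symm B U) {w : E} {m : ℝ} (hm : 0 < m)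
    (hw : ∀ y ∈ B, g.IsFutureCausal (chartFrame p ((extChartAt 𝓘(ℝ, E) p).symm y) w))
    (hmw : ∀ y ∈ B, m ^ 2 ≤ h.inner ((extChartAt 𝓘(ℝ, E) p).symm y)
      (chartFrame p ((extChartAt 𝓘(ℝ, E) p).symm y) w)
      (chartFrame p ((extChartAt 𝓘(ℝ, E) p).symm y) w))
    {y : E} (hy : y ∈ B) {t : ℝ} (ht : 0 ≤ t) (hyt : y + t • w ∈ B) :
    C * (m * t) ≤ τ ((extChartAt 𝓘(ℝ, E) p).symm (y + t • w)) -
      τ ((extChartAt 𝓘(ℝ, E) p).symm y) := by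
  set φ := extChartAt 𝓘(ℝ, E) p with hφ
  have hseg : ∀ r ∈ Icc 0 t, y + r • w ∈ B := fun r hr ↦ by
    rcases ht.eq_or_lt with h0 | h0
    · have : r = 0 := le_antisymm (hr.2.trans h0.ge) hr.1
      simpa [this] using hy
    · have := hBconv.add_smul_mem hy hyt (t := r / t) ⟨by have := hr.1; positivity,
        (div_le_one h0).2 hr.2⟩
      rwa [smul_smul, div_mul_cancel₀ _ h0.ne'] at this
  let H : E → ℝ := fun z ↦ h.inner (φ.symm z) (chartFrame p (φ.symm z) w)
    (chartFrame p (φ.symm z) w)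
  have hsrc : ∀ z ∈ B, φ.symm z ∈ (chartAt E p).source := fun z hz ↦ by
    simpa [hφ] using φ.map_target (hBt hz)
  have hHcont : ContinuousOn H B := fun z hz ↦ by
    have h1 : ContinuousAt φ.symm z := continuousAt_extChartAt_symm'' (hBt hz)
    have h2 : ContinuousWithinAt
        (fun z ↦ (⟨φ.symm z, chartFrame p (φ.symm z) w⟩ : TangentBundle 𝓘(ℝ, E) M)) B z := by
      refine ContinuousAt.continuousWithinAt ?_
      exact ((continuousOn_chartFrame p).continuousAt (x := (φ.symm z, w)) (prod_mem_nhds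
        ((chartAt E p).open_source.mem_nhds (hsrc z hz)) Filter.univ_mem)).comp
        (f := fun z ↦ (φ.symm z, w)) (by fun_prop)
    exact ContinuousWithinAt.bilinForm_apply h.contMDiff.continuous h2 h2
  -- The speed is extended constantly beyond `[0, t]`, so that the reparametrisation `σ` is defined
  -- on all of `ℝ` and the curve is differentiable from both sides at its endpoints.
  let ρ : ℝ → ℝ := IccExtend ht (fun r : Icc 0 t ↦ √(H (y + (r : ℝ) • w)))
  have hρcont : Continuous ρ := by
    refine Continuous.Icc_extend' ?_
    refine Real.continuous_sqrt.comp ?_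
    refine hHcont.comp_continuous (by fun_prop) fun r ↦ hseg r r.2
  have hρm : ∀ r, m ≤ ρ r := fun r ↦
    Real.le_sqrt_of_sq_le (hmw _ (hseg _ (projIcc 0 t ht r).2))
  obtain ⟨σ, hσmono, hσ0, hσd, hσs⟩ := exists_arcLength_inverse hρcont hm hρm
  obtain ⟨S, hS, hσS⟩ := hσs t ht
  have hS0 : 0 ≤ S := le_trans (by positivity) hS
  have hσJ : ∀ s ∈ Icc 0 S, σ s ∈ Icc 0 t := fun s hs ↦
    ⟨hσ0 ▸ hσmono.monotone hs.1, hσS ▸ hσmono.monotone hs.2⟩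
  have hσc : Continuous σ := continuous_iff_continuousAt.2 fun s ↦ (hσd s).continuousAt
  have hσ1 : ContDiff ℝ 1 σ := by
    rw [contDiff_one_iff_deriv]
    refine ⟨fun s ↦ (hσd s).differentiableAt, ?_⟩
    rw [show deriv σ = fun s ↦ (ρ (σ s))⁻¹ from funext fun s ↦ (hσd s).deriv]
    exact (hρcont.comp hσc).inv₀ fun s ↦ (hm.trans_le (hρm _)).ne'
  let c : ℝ → E := fun s ↦ y + σ s • w
  let γ : ℝ → M := fun s ↦ φ.symm (c s)
  have hcB : ∀ s ∈ Icc 0 S, c s ∈ B := fun s hs ↦ hseg _ (hσJ s hs)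
  have hcd : ∀ s, HasDerivAt c ((ρ (σ s))⁻¹ • w) s := fun s ↦
    ((hσd s).smul_const w).const_add y
  have hγd : ∀ s ∈ Icc 0 S, HasMFDerivAt 𝓘(ℝ, ℝ) 𝓘(ℝ, E) γ s
      ((chartFrame (E := E) p (γ s)).comp (ContinuousLinearMap.toSpanSingleton ℝ ((ρ (σ s))⁻¹ • w))) :=
    fun s hs ↦ (hasMFDerivAt_extChartAt_symm_chartFrame p (hBt (hcB s hs))).comp s
      (hcd s).hasFDerivAt.hasMFDerivAt
  have hvel : ∀ s ∈ Icc 0 S, curveVelocity E γ s = (ρ (σ s))⁻¹ • chartFrame p (γ s) w :=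
    fun s hs ↦ by
      rw [curveVelocity, (hγd s hs).mfderiv]
      change chartFrame p (γ s) ((1 : ℝ) • (ρ (σ s))⁻¹ • w) = _
      rw [one_smul, map_smul]
  have hρpos : ∀ s, 0 < (ρ (σ s))⁻¹ := fun s ↦ inv_pos.2 (hm.trans_le (hρm _))
  have hγ1 : ∀ s ∈ Icc 0 S, ContMDiffAt 𝓘(ℝ, ℝ) 𝓘(ℝ, E) 1 γ s := fun s hs ↦ by
    have h1 : ContMDiffAt 𝓘(ℝ, E) 𝓘(ℝ, E) 1 φ.symm (c s) :=
      ((contMDiffOn_extChartAt_symm (n := ∞) p).contMDiffAt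
        ((isOpen_extChartAt_target p).mem_nhds (hBt (hcB s hs)))).of_le (by norm_cast)
    have h2 : ContDiff ℝ 1 c := contDiff_const.add (hσ1.smul contDiff_const)
    exact h1.comp s h2.contDiffAt.contMDiffAt
  have hcausal : g.IsFutureCausalCurveOn γ (Icc 0 S) := by
    refine ⟨ordConnected_Icc, isLocallyLipschitzCurveOn_of_contMDiffAt hγ1,
      Filter.Eventually.of_forall fun s hs ↦ ⟨(hγd s hs).mdifferentiableAt, ?_⟩⟩
    obtain ⟨h1, h2, h3⟩ := hw _ (hcB s hs)
    rw [hvel s hs]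
    refine ⟨smul_ne_zero (hρpos s).ne' h1, ?_, ?_⟩
    · simp only [map_smul, smul_apply, smul_eq_mul]
      exact mul_nonpos_of_nonneg_of_nonpos (hρpos s).le
        (mul_nonpos_of_nonneg_of_nonpos (hρpos s).le h2)
    · simp only [map_smul, smul_apply, smul_eq_mul]
      exact mul_neg_of_pos_of_neg (hρpos s) h3
  have harc : IsArcLengthParametrisedOn h γ (Icc 0 S) := by
    refine Filter.Eventually.of_forall fun s hs ↦ ?_
    rw [hvel s hs]
    have hH : 0 ≤ H (c s) := (sq_nonneg m).trans (hmw _ (hcB s hs))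
    have hρs : ρ (σ s) = √(H (c s)) := IccExtend_of_mem ht _ (hσJ s hs)
    have : H (c s) = ρ (σ s) ^ 2 := by rw [hρs, Real.sq_sqrt hH]
    simp only [map_smul, smul_apply, smul_eq_mul]
    change (ρ (σ s))⁻¹ * ((ρ (σ s))⁻¹ * H (c s)) = 1
    have := (hm.trans_le (hρm (σ s))).ne'
    rw [‹H (c s) = _›]
    field_simp
  have hfin := hU γ (Icc 0 S) hcausal harc (fun s hs ↦ hBU (hcB s hs)) 0 ⟨le_rfl, hS0⟩ S
    ⟨hS0, le_rfl⟩ hS0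
  simp only [γ, c, hσ0, hσS, zero_smul, add_zero, sub_zero] at hfin
  exact (mul_le_mul_of_nonneg_left hS hC.le).trans hfin

end ChartLines

/-! ### Local estimates for functions, metrics and cones -/

section LocalEstimates

/-- A function whose increments in the direction of the velocity of a curve are bounded below has
derivative bounded below along the curve. -/
lemma le_of_hasDerivAt_comp_of_eventually_le {E : Type*} [NormedAddCommGroup E] [NormedSpace ℝ E]
    {F : E → ℝ} {c : ℝ → E} {v : E} {s f' κ : ℝ} {K : NNReal} {V : Set E}
    (hc : HasDerivAt c v s) (hV : V ∈ 𝓝 (c s)) (hF : LipschitzOnWith K F V)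
    (hf : HasDerivAt (fun r ↦ F (c r)) f' s)
    (hκ : ∀ᶠ u in 𝓝[>] (0 : ℝ), κ * u ≤ F (c s + u • v) - F (c s)) : κ ≤ f' := by
  have h1 := hf.tendsto_slope_zero_right
  have h2 := hc.tendsto_slope_zero_right
  -- The curve point `c (s + u)` differs from the tangent point `c s + u • v` by `o(u)`; the second
  -- summand bounds the resulting error in `F` and tends to zero.
  have h3 : Filter.Tendsto (fun u : ℝ ↦ u⁻¹ • (F (c (s + u)) - F (c s)) +
      K * ‖u⁻¹ • (c (s + u) - c s) - v‖) (𝓝[>] 0) (𝓝 (f' + K * ‖v - v‖)) :=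
    h1.add ((h2.sub_const v).norm.const_mul _)
  rw [sub_self, norm_zero, mul_zero, add_zero] at h3
  refine ge_of_tendsto h3 ?_
  have e1 : ∀ᶠ u in 𝓝[>] (0 : ℝ), c (s + u) ∈ V := by
    refine Filter.Eventually.filter_mono nhdsWithin_le_nhds ?_
    have : ContinuousAt (fun u ↦ c (s + u)) 0 :=
      ContinuousAt.comp (g := c) (by simpa using hc.continuousAt) (by fun_prop)
    exact this.eventually_mem (by simpa using hV)
  have e2 : ∀ᶠ u in 𝓝[>] (0 : ℝ), c s + u • v ∈ V := by
    refine Filter.Eventually.filter_mono nhdsWithin_le_nhds ?_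
    have : ContinuousAt (fun u : ℝ ↦ c s + u • v) 0 := by fun_prop
    exact this.eventually_mem (by simpa using hV)
  filter_upwards [hκ, e1, e2, self_mem_nhdsWithin] with u h4 h5 h6 hu
  have hu : 0 < u := hu
  have h7 := (abs_le.1 (by simpa [Real.norm_eq_abs] using hF.norm_sub_le h5 h6)).1
  have h8 : ‖c (s + u) - (c s + u • v)‖ = u * ‖u⁻¹ • (c (s + u) - c s) - v‖ := by
    rw [← abs_of_pos hu, ← Real.norm_eq_abs, ← norm_smul, Real.norm_eq_abs, abs_of_pos hu, smul_sub,
      smul_smul, mul_inv_cancel₀ hu.ne', one_smul, sub_sub]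
  rw [h8] at h7
  have h9 : κ * u ≤ (u⁻¹ • (F (c (s + u)) - F (c s)) +
      K * ‖u⁻¹ • (c (s + u) - c s) - v‖) * u := by
    have : u⁻¹ • (F (c (s + u)) - F (c s)) * u = F (c (s + u)) - F (c s) := by
      rw [smul_eq_mul]; field_simp
    rw [add_mul, this]
    linarith
  exact le_of_mul_le_mul_right h9 hu

variable {E : Type*} [NormedAddCommGroup E] [NormedSpace ℝ E]
  {M : Type*} [TopologicalSpace M] [ChartedSpace E M]

/-- Both Lipschitz conditions are read in the chart at `γ s`, so the constants multiply once the
curve is kept inside the source of that chart. -/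
lemma IsLocallyLipschitzFun.comp_curve {τ : M → ℝ} (hτ : IsLocallyLipschitzFun E τ) {γ : ℝ → M}
    {J : Set ℝ} (hγ : IsLocallyLipschitzCurveOn E γ J) :
    LocallyLipschitzOn J fun s ↦ τ (γ s) := by
  intro s hs
  obtain ⟨K₁, V₁, hV₁, hK₁⟩ := hγ.2 s hs
  obtain ⟨K₂, V₂, hV₂, hK₂⟩ := hτ (γ s)
  have hcont := hγ.1 s hs
  have h1 : γ ⁻¹' (extChartAt 𝓘(ℝ, E) (γ s)).source ∈ 𝓝[J] s :=
    hcont (extChartAt_source_mem_nhds (γ s))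
  have h2 : (fun t ↦ extChartAt 𝓘(ℝ, E) (γ s) (γ t)) ⁻¹' V₂ ∈ 𝓝[J] s :=
    ((continuousAt_extChartAt (I := 𝓘(ℝ, E)) (γ s)).comp_continuousWithinAt hcont) hV₂
  refine ⟨K₂ * K₁, _, Filter.inter_mem hV₁ (Filter.inter_mem h1 h2), ?_⟩
  have hL := hK₂.comp (hK₁.mono (s := V₁ ∩ (γ ⁻¹' (extChartAt 𝓘(ℝ, E) (γ s)).source ∩
    (fun t ↦ extChartAt 𝓘(ℝ, E) (γ s) (γ t)) ⁻¹' V₂)) inter_subset_left) fun t ht ↦ ht.2.2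
  intro t ht t' ht'
  have := hL ht ht'
  simpa only [Function.comp_apply, (extChartAt 𝓘(ℝ, E) (γ s)).left_inv ht.2.1,
    (extChartAt 𝓘(ℝ, E) (γ s)).left_inv ht'.2.1] using this

variable [IsManifold 𝓘(ℝ, E) ∞ M]

lemma continuousAt_bilinForm_chartFrame
    {b : ∀ x : M, TangentSpace 𝓘(ℝ, E) x →L[ℝ] TangentSpace 𝓘(ℝ, E) x →L[ℝ] ℝ}
    (hb : Continuous fun x : M ↦
      (Bundle.TotalSpace.mk' (E →L[ℝ] E →L[ℝ] ℝ) x (b x) :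
        Bundle.TotalSpace (E →L[ℝ] E →L[ℝ] ℝ) fun x : M ↦
          TangentSpace 𝓘(ℝ, E) x →L[ℝ] TangentSpace 𝓘(ℝ, E) x →L[ℝ] ℝ)) (p : M) (v : E) :
    ContinuousAt (fun z : M × E ↦ b z.1 (chartFrame p z.1 z.2) (chartFrame p z.1 z.2)) (p, v) := by
  have h1 := ((continuousOn_chartFrame p).continuousAt (x := (p, v)) (prod_mem_nhds
        ((chartAt E p).open_source.mem_nhds (mem_chart_source E p)) Filter.univ_mem))
  rw [← continuousWithinAt_univ] at *
  exact ContinuousWithinAt.bilinForm_apply hb h1 h1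

lemma SpacetimeMetric.continuousAt_inner_timeField_chartFrame (g : SpacetimeMetric E M)
    (p : M) (v : E) :
    ContinuousAt (fun z : M × E ↦ g.inner z.1 (chartFrame p z.1 z.2) (g.timeField z.1)) (p, v) := by
  have h1 := ((continuousOn_chartFrame p).continuousAt (x := (p, v)) (prod_mem_nhds
        ((chartAt E p).open_source.mem_nhds (mem_chart_source E p)) Filter.univ_mem))
  have h2 : ContinuousAt (fun z : M × E ↦ (⟨z.1, g.timeField z.1⟩ : TangentBundle 𝓘(ℝ, E) M))
      (p, v) := (g.continuous_timeField.comp continuous_fst).continuousAt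
  rw [← continuousWithinAt_univ] at *
  exact ContinuousWithinAt.bilinForm_apply g.continuous_inner h1 h2

/-- A Riemannian metric is locally comparable to the norm of the model space. -/
lemma exists_nhds_riemannian_comparable [FiniteDimensional ℝ E]
    (h : Bundle.ContMDiffRiemannianMetric 𝓘(ℝ, E) ∞ E fun x : M ↦ TangentSpace 𝓘(ℝ, E) x) (p : M) :
    ∃ a > 0, ∃ b > 0, ∃ N ∈ 𝓝 p, ∀ x ∈ N, ∀ v : E,
      (a * ‖v‖) ^ 2 ≤ h.inner x (chartFrame p x v) (chartFrame p x v) ∧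
      h.inner x (chartFrame p x v) (chartFrame p x v) ≤ (b * ‖v‖) ^ 2 := by
  have hcont := continuousAt_bilinForm_chartFrame h.contMDiff.continuous p
  have hK : IsCompact (Metric.sphere (0 : E) 1) := isCompact_sphere 0 1
  have hcp : Continuous fun v : E ↦ h.inner p (chartFrame p p v) (chartFrame p p v) :=
    continuous_iff_continuousAt.2 fun v ↦ (hcont v).comp (f := fun v ↦ (p, v)) (by fun_prop)
  obtain ⟨a, ha, hav⟩ := hK.exists_forall_le' hcp.continuousOn (a := 0) fun v hv ↦ by
    refine h.pos _ _ fun h0 ↦ ?_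
    have : v = 0 := chartFrame_injective (mem_chart_source E p) (by rw [h0, map_zero])
    simp [this] at hv
  obtain ⟨b, hb⟩ := (hK.image hcp).bddAbove
  have hb' : ∀ v ∈ Metric.sphere (0 : E) 1, h.inner p (chartFrame p p v) (chartFrame p p v) ≤ b :=
    fun v hv ↦ hb (mem_image_of_mem _ hv)
  have hev : ∀ᶠ x in 𝓝 p, ∀ v ∈ Metric.sphere (0 : E) 1,
      a / 2 < h.inner x (chartFrame p x v) (chartFrame p x v) ∧
      h.inner x (chartFrame p x v) (chartFrame p x v) < |b| + 1 := by
    refine hK.eventually_forall_of_forall_eventually fun v hv ↦ ?_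
    exact ((hcont v).eventually (lt_mem_nhds ((half_lt_self ha).trans_le (hav v hv)))).and
      ((hcont v).eventually (gt_mem_nhds
        (((hb' v hv).trans (le_abs_self b)).trans_lt (lt_add_one _))))
  -- Both estimates pass from the unit sphere to all `v` by homogeneity. Using `|b| + 1` keeps the
  -- upper constant positive even if the sphere is empty.
  refine ⟨√(a / 2), Real.sqrt_pos.2 (by positivity), √(|b| + 1), Real.sqrt_pos.2 (by positivity),
    _, hev, fun x hx v ↦ ?_⟩
  rw [mul_pow, mul_pow, Real.sq_sqrt (by positivity), Real.sq_sqrt (by positivity)]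
  rcases eq_or_ne v 0 with rfl | hv
  · simp
  have hn : 0 < ‖v‖ := norm_pos_iff.2 hv
  have hs : ‖v‖⁻¹ • v ∈ Metric.sphere (0 : E) 1 := by
    simp [norm_smul, hn.ne']
  have h1 : h.inner x (chartFrame p x v) (chartFrame p x v) =
      h.inner x (chartFrame p x (‖v‖⁻¹ • v)) (chartFrame p x (‖v‖⁻¹ • v)) * ‖v‖ ^ 2 := by
    simp only [map_smul, smul_apply, smul_eq_mul]
    field_simp
  obtain ⟨h2, h3⟩ := hx _ hs
  rw [h1]
  exact ⟨by gcongr, by gcongr⟩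

/-- Vectors in a slight widening of the cones near `p` become timelike at all nearby points when a
small multiple of the time field is added to them. -/
lemma SpacetimeMetric.exists_nhds_timelike_of_add [FiniteDimensional ℝ E] (g : SpacetimeMetric E M)
    (p : M) {T₀ : E} (hT₀ : chartFrame p p T₀ = g.timeField p) {δ : ℝ} (hδ : 0 < δ) :
    ∃ e > 0, ∃ N ∈ 𝓝 p, ∀ x ∈ N, ∀ v : E, ‖v‖ = 1 →
      g.inner x (chartFrame p x v) (chartFrame p x v) ≤
        e * g.inner x (chartFrame p x v) (g.timeField x) ^ 2 →
      g.inner x (chartFrame p x v) (g.timeField x) < 0 →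
      ∀ x' ∈ N, g.IsFutureTimelike (chartFrame p x' (v + δ • T₀)) := by
  let G : M × E → ℝ := fun z ↦ g.inner z.1 (chartFrame p z.1 z.2) (chartFrame p z.1 z.2)
  let θ : M × E → ℝ := fun z ↦ g.inner z.1 (chartFrame p z.1 z.2) (g.timeField z.1)
  have hG : ∀ v, ContinuousAt G (p, v) := continuousAt_bilinForm_chartFrame g.continuous_inner p
  have hθ : ∀ v, ContinuousAt θ (p, v) := g.continuousAt_inner_timeField_chartFrame p
  -- The cone width is treated as a variable near `0`, alongside the two base points, so that one
  -- compactness argument over the sphere yields both `e` and the neighbourhood.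
  have hev : ∀ᶠ z : ℝ × M × M in 𝓝 (0, p, p), ∀ v ∈ Metric.sphere (0 : E) 1,
      G (z.2.1, v) ≤ z.1 * θ (z.2.1, v) ^ 2 → θ (z.2.1, v) < 0 →
        G (z.2.2, v + δ • T₀) < 0 ∧ θ (z.2.2, v + δ • T₀) < 0 := by
    refine (isCompact_sphere 0 1).eventually_forall_of_forall_eventually fun v _ ↦ ?_
    have hG1 : ContinuousAt (fun z : (ℝ × M × M) × E ↦ G (z.1.2.1, z.2)) ((0, p, p), v) :=
      ContinuousAt.comp (x := ((0, p, p), v)) (f := fun z : (ℝ × M × M) × E ↦ (z.1.2.1, z.2)) (hG v) (by fun_prop)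
    have hθ1 : ContinuousAt (fun z : (ℝ × M × M) × E ↦ θ (z.1.2.1, z.2)) ((0, p, p), v) :=
      ContinuousAt.comp (x := ((0, p, p), v)) (f := fun z : (ℝ × M × M) × E ↦ (z.1.2.1, z.2)) (hθ v) (by fun_prop)
    have hG2 : ContinuousAt (fun z : (ℝ × M × M) × E ↦ G (z.1.2.2, z.2 + δ • T₀)) ((0, p, p), v) :=
      ContinuousAt.comp (x := ((0, p, p), v)) (f := fun z : (ℝ × M × M) × E ↦ (z.1.2.2, z.2 + δ • T₀)) (hG _)
        (by fun_prop)
    have hθ2 : ContinuousAt (fun z : (ℝ × M × M) × E ↦ θ (z.1.2.2, z.2 + δ • T₀)) ((0, p, p), v) :=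
      ContinuousAt.comp (x := ((0, p, p), v)) (f := fun z : (ℝ × M × M) × E ↦ (z.1.2.2, z.2 + δ • T₀)) (hθ _)
        (by fun_prop)
    -- If `θ > 0` or `G > 0` at `(p, v)`, a hypothesis on the direction fails nearby. Otherwise `θ ≤
    -- 0` and `G ≤ 0`, and adding `δ T₀` makes both strictly negative, which is an open condition.
    rcases lt_or_ge 0 (θ (p, v)) with h1 | h1
    · filter_upwards [hθ1.eventually (lt_mem_nhds h1)] with z hz _ hz2
      exact absurd hz2 (not_lt.2 hz.le)
    rcases lt_or_ge 0 (G (p, v)) with h2 | h2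
    · have h3 : ContinuousAt (fun z : (ℝ × M × M) × E ↦
          G (z.1.2.1, z.2) - z.1.1 * θ (z.1.2.1, z.2) ^ 2) ((0, p, p), v) :=
        hG1.sub (ContinuousAt.mul (by fun_prop) (hθ1.pow 2))
      filter_upwards [h3.eventually (lt_mem_nhds (a := 0) (by simpa using h2))] with z hz hz1 _
      linarith
    have hT := g.timeField_timelike p
    have h3 : θ (p, v + δ • T₀) = θ (p, v) + δ * g.inner p (g.timeField p) (g.timeField p) := by
      simp only [θ, map_add, map_smul, hT₀, add_apply, smul_apply, smul_eq_mul]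
    have h4 : G (p, v + δ • T₀) = G (p, v) + 2 * δ * θ (p, v) +
        δ ^ 2 * g.inner p (g.timeField p) (g.timeField p) := by
      simp only [G, θ, map_add, map_smul, hT₀, add_apply, smul_apply, smul_eq_mul]
      rw [g.symm p (g.timeField p) (chartFrame p p v)]
      ring
    have h5 : θ (p, v + δ • T₀) < 0 := by
      rw [h3]; nlinarith [mul_pos hδ (neg_pos.2 hT)]
    have h6 : G (p, v + δ • T₀) < 0 := by
      rw [h4]
      nlinarith [mul_pos (pow_pos hδ 2) (neg_pos.2 hT), mul_nonneg hδ.le (neg_nonneg.2 h1)]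
    filter_upwards [hG2.eventually (gt_mem_nhds h6), hθ2.eventually (gt_mem_nhds h5)] with z hz hz'
    exact fun _ _ ↦ ⟨hz, hz'⟩
  rw [nhds_prod_eq, nhds_prod_eq] at hev
  obtain ⟨A, hA, A', hA', hAA⟩ := Filter.mem_prod_iff.1 hev
  obtain ⟨N₁, hN₁, N₂, hN₂, hN⟩ := Filter.mem_prod_iff.1 hA'
  obtain ⟨r, hr, hrA⟩ := Metric.mem_nhds_iff.1 hA
  refine ⟨r / 2, by positivity, N₁ ∩ N₂, Filter.inter_mem hN₁ hN₂,
    fun x hx v hv hGv hθv x' hx' ↦ ?_⟩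
  have hmem : (r / 2, x, x') ∈ A ×ˢ A' :=
    ⟨hrA (by rw [Metric.mem_ball, Real.dist_eq, sub_zero, abs_of_pos (by positivity)]; linarith),
      hN ⟨hx.1, hx'.2⟩⟩
  exact hAA hmem v (by simpa using hv) hGv hθv

end LocalEstimates

/-! ### Anti-Lipschitz bounds for wider cones -/

section AntiLipschitz

variable {E : Type*} [NormedAddCommGroup E] [NormedSpace ℝ E] [FiniteDimensional ℝ E]
  {M : Type*} [TopologicalSpace M] [ChartedSpace E M] [IsManifold 𝓘(ℝ, E) ∞ M]

/-- In a chart, a locally Lipschitz and locally anti-Lipschitz function grows at a definite rate in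
all directions of a slightly wider cone. -/
lemma SpacetimeMetric.IsLocallyAntiLipschitz.exists_chart_growth {g : SpacetimeMetric E M}
    {h : Bundle.ContMDiffRiemannianMetric 𝓘(ℝ, E) ∞ E fun x : M ↦ TangentSpace 𝓘(ℝ, E) x}
    {τ : M → ℝ} (hLip : IsLocallyLipschitzFun E τ) (hAnti : g.IsLocallyAntiLipschitz h τ) (p : M) :
    ∃ e > 0, ∃ k > 0, ∃ K : NNReal, ∃ B : Set E, IsOpen B ∧ extChartAt 𝓘(ℝ, E) p p ∈ B ∧
      B ⊆ (extChartAt 𝓘(ℝ, E) p).target ∧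
      IsCompact (closure ((extChartAt 𝓘(ℝ, E) p).symm '' B)) ∧
      LipschitzOnWith K (fun y ↦ τ ((extChartAt 𝓘(ℝ, E) p).symm y)) B ∧
      ∀ y ∈ B, ∀ x, x = (extChartAt 𝓘(ℝ, E) p).symm y → ∀ v : E,
        h.inner x (chartFrame p x v) (chartFrame p x v) = 1 →
        g.inner x (chartFrame p x v) (chartFrame p x v) ≤
          e * g.inner x (chartFrame p x v) (g.timeField x) ^ 2 →
        g.inner x (chartFrame p x v) (g.timeField x) < 0 →
        ∀ᶠ u in 𝓝[>] (0 : ℝ), k * u ≤ τ ((extChartAt 𝓘(ℝ, E) p).symm (y + u • v)) -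
          τ ((extChartAt 𝓘(ℝ, E) p).symm y) := by
  set φ := extChartAt 𝓘(ℝ, E) p with hφ
  obtain ⟨U, hU, hUc, C, hC, hUC⟩ := hAnti p
  obtain ⟨K, V, hV, hK⟩ := hLip p
  obtain ⟨a, ha, b, hb, N₁, hN₁, hab⟩ := exists_nhds_riemannian_comparable h p
  set T₀ : E := mfderiv 𝓘(ℝ, E) 𝓘(ℝ, E) φ p (g.timeField p)
  have hT₀ : chartFrame p p T₀ = g.timeField p := chartFrame_mfderiv (mem_chart_source E p) _
  -- The first condition gives `‖w‖ ≥ 1/2` for the tilted vector `w`, hence growth rate `C * a / 2`;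
  -- the second limits the Lipschitz loss to half of that rate.
  obtain ⟨δ, hδ, hδ1, hδ2⟩ : ∃ δ > 0, δ * ‖T₀‖ ≤ 1 / 2 ∧ K * (δ * ‖T₀‖) ≤ C * a / 4 := by
    have h1 : ∀ᶠ δ in 𝓝[>] (0 : ℝ), δ * ‖T₀‖ ≤ 1 / 2 := by
      refine Filter.Eventually.filter_mono nhdsWithin_le_nhds ?_
      have : ContinuousAt (fun δ : ℝ ↦ δ * ‖T₀‖) 0 := by fun_prop
      exact this.eventually (ge_mem_nhds (by norm_num))
    have h2 : ∀ᶠ δ in 𝓝[>] (0 : ℝ), K * (δ * ‖T₀‖) ≤ C * a / 4 := by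
      refine Filter.Eventually.filter_mono nhdsWithin_le_nhds ?_
      have : ContinuousAt (fun δ : ℝ ↦ K * (δ * ‖T₀‖)) 0 := by fun_prop
      exact this.eventually (ge_mem_nhds (by simp only [zero_mul, mul_zero]; positivity))
    have h0 : ∀ᶠ δ in 𝓝[>] (0 : ℝ), 0 < δ := self_mem_nhdsWithin
    obtain ⟨δ, hδ, h3, h4⟩ := (h0.and (h1.and h2)).exists
    exact ⟨δ, hδ, h3, h4⟩
  obtain ⟨e, he, N₂, hN₂, hcone⟩ := g.exists_nhds_timelike_of_add p hT₀ hδ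
  have hsymm : ContinuousAt φ.symm (φ p) := continuousAt_extChartAt_symm p
  have hpre : φ.symm ⁻¹' (U ∩ (N₁ ∩ N₂)) ∈ 𝓝 (φ p) :=
    hsymm (by rw [hφ, extChartAt_to_inv]; exact Filter.inter_mem hU (Filter.inter_mem hN₁ hN₂))
  obtain ⟨r, hr, hball⟩ := Metric.mem_nhds_iff.1
    (Filter.inter_mem (extChartAt_target_mem_nhds (I := 𝓘(ℝ, E)) p) (Filter.inter_mem hV hpre))
  set B := Metric.ball (φ p) r
  have hBt : B ⊆ φ.target := fun y hy ↦ (hball hy).1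
  have hBV : B ⊆ V := fun y hy ↦ (hball hy).2.1
  have hBU : MapsTo φ.symm B U := fun y hy ↦ (hball hy).2.2.1
  -- The net rate `C * a / 2 - C * a / 4` is per unit of chart length, and an `h`-unit vector has
  -- chart norm at least `b⁻¹`.
  refine ⟨e, he, C * a / 4 * b⁻¹, by positivity, K, B, Metric.isOpen_ball, Metric.mem_ball_self hr,
    hBt, hUc.of_isClosed_subset isClosed_closure (closure_mono hBU.image_subset), hK.mono hBV, ?_⟩
  rintro y hy x rfl v hv hgv hθv
  have hyN := (hball hy).2.2.2
  have hbv : 1 ≤ b * ‖v‖ := by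
    have := (hab _ hyN.1 v).2
    rw [hv] at this
    exact (one_le_sq_iff₀ (by positivity)).1 this
  have hv0 : 0 < ‖v‖ := by
    by_contra! h0
    have : ‖v‖ = 0 := le_antisymm h0 (norm_nonneg v)
    rw [this] at hbv; linarith
  set v₁ : E := ‖v‖⁻¹ • v with hv₁
  have hv₁n : ‖v₁‖ = 1 := by simp [hv₁, norm_smul, hv0.ne']
  set w : E := v₁ + δ • T₀ with hw
  have hwT : ∀ z ∈ B, g.IsFutureTimelike (chartFrame p (φ.symm z) w) := fun z hz ↦ by
    refine hcone _ hyN.2 v₁ hv₁n ?_ ?_ _ (hball hz).2.2.2.2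
    · simp only [hv₁, map_smul, smul_apply, smul_eq_mul]
      have := mul_le_mul_of_nonneg_left hgv (sq_nonneg ‖v‖⁻¹)
      linarith
    · simp only [hv₁, map_smul, smul_apply, smul_eq_mul]
      exact mul_neg_of_pos_of_neg (inv_pos.2 hv0) hθv
  have hwC : ∀ z ∈ B, g.IsFutureCausal (chartFrame p (φ.symm z) w) := fun z hz ↦ by
    obtain ⟨h1, h2⟩ := hwT z hz
    exact ⟨fun h0 ↦ by simp [h0] at h1, h1.le, h2⟩
  have hδT : ‖δ • T₀‖ = δ * ‖T₀‖ := by rw [norm_smul, Real.norm_eq_abs, abs_of_pos hδ]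
  have hwn : 1 / 2 ≤ ‖w‖ := by
    have := norm_sub_norm_le v₁ (-(δ • T₀))
    rw [sub_neg_eq_add, norm_neg, hv₁n, hδT] at this
    linarith
  have hmw : ∀ z ∈ B, (a / 2) ^ 2 ≤ h.inner (φ.symm z) (chartFrame p (φ.symm z) w)
      (chartFrame p (φ.symm z) w) := fun z hz ↦ by
    refine le_trans ?_ (hab _ (hball hz).2.2.2.1 w).1
    have : a / 2 ≤ a * ‖w‖ := by nlinarith
    gcongr
  have hyB : B ∈ 𝓝 y := Metric.isOpen_ball.mem_nhds hy
  have hevB : ∀ z : E, ∀ᶠ u in 𝓝[>] (0 : ℝ), y + (u * ‖v‖) • z ∈ B := fun z ↦ by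
    refine Filter.Eventually.filter_mono nhdsWithin_le_nhds ?_
    have : ContinuousAt (fun u : ℝ ↦ y + (u * ‖v‖) • z) 0 := by fun_prop
    exact this.eventually_mem (by simpa using hyB)
  filter_upwards [hevB v₁, hevB w, self_mem_nhdsWithin] with u hu1 hu2 hu
  have hu : 0 < u := hu
  have huv : 0 < u * ‖v‖ := mul_pos hu hv0
  have hline := g.mul_le_sub_of_chart_segment h hC hUC (convex_ball _ _) hBt hBU
    (half_pos ha) hwC hmw hy huv.le hu2
  have hlip : |τ (φ.symm (y + (u * ‖v‖) • v₁)) - τ (φ.symm (y + (u * ‖v‖) • w))| ≤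
      K * ‖y + (u * ‖v‖) • v₁ - (y + (u * ‖v‖) • w)‖ := hK.norm_sub_le (hBV hu1) (hBV hu2)
  replace hlip := (abs_le.1 hlip).1
  have hdiff : ‖y + (u * ‖v‖) • v₁ - (y + (u * ‖v‖) • w)‖ = u * ‖v‖ * (δ * ‖T₀‖) := by
    rw [hw, smul_add, add_sub_add_left_eq_sub, sub_add_cancel_left, norm_neg, norm_smul, hδT,
      Real.norm_eq_abs, abs_of_pos huv]
  rw [hdiff] at hlip
  have huv₁ : (u * ‖v‖) • v₁ = u • v := by
    rw [hv₁, smul_smul, mul_assoc, mul_inv_cancel₀ hv0.ne', mul_one]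
  rw [huv₁] at hlip
  have h1 : K * (u * ‖v‖ * (δ * ‖T₀‖)) ≤ u * ‖v‖ * (C * a / 4) := by
    have := mul_le_mul_of_nonneg_left hδ2 huv.le
    linarith
  have h2 : C * a / 4 * b⁻¹ * u ≤ u * ‖v‖ * (C * a / 4) := by
    have h3 : b⁻¹ ≤ ‖v‖ := by
      rw [inv_le_iff_one_le_mul₀ hb]; linarith
    have := mul_le_mul_of_nonneg_left h3 (show 0 ≤ C * a / 4 * u by positivity)
    linarith
  linarith

/-- A locally Lipschitz and locally anti-Lipschitz function is anti-Lipschitz, near each point,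
along all curves that are causal for a slightly wider cone. -/
lemma SpacetimeMetric.IsLocallyAntiLipschitz.exists_nhds_wider {g : SpacetimeMetric E M}
    {h : Bundle.ContMDiffRiemannianMetric 𝓘(ℝ, E) ∞ E fun x : M ↦ TangentSpace 𝓘(ℝ, E) x}
    {τ : M → ℝ} (hLip : IsLocallyLipschitzFun E τ) (hAnti : g.IsLocallyAntiLipschitz h τ) (p : M) :
    ∃ e > 0, ∃ O : Set M, IsOpen O ∧ p ∈ O ∧ IsCompact (closure O) ∧ ∃ k > 0,
      ∀ (γ : ℝ → M) (J : Set ℝ), J.OrdConnected → IsLocallyLipschitzCurveOn E γ J →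
        (∀ᵐ s : ℝ, s ∈ J → MDifferentiableAt 𝓘(ℝ, ℝ) 𝓘(ℝ, E) γ s ∧
          g.inner (γ s) (curveVelocity E γ s) (curveVelocity E γ s) ≤
            e * g.inner (γ s) (curveVelocity E γ s) (g.timeField (γ s)) ^ 2 ∧
          g.inner (γ s) (curveVelocity E γ s) (g.timeField (γ s)) < 0) →
        IsArcLengthParametrisedOn h γ J → MapsTo γ J O →
        ∀ s₁ ∈ J, ∀ s₂ ∈ J, s₁ ≤ s₂ → k * (s₂ - s₁) ≤ τ (γ s₂) - τ (γ s₁) := by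
  obtain ⟨e, he, k, hk, K, B, hBo, hpB, hBt, hBc, hK, hgrow⟩ := hAnti.exists_chart_growth hLip p
  set φ := extChartAt 𝓘(ℝ, E) p with hφ
  have hOB : φ.source ∩ φ ⁻¹' B ⊆ φ.symm '' B := fun x hx ↦ ⟨φ x, hx.2, φ.left_inv hx.1⟩
  have hO : IsOpen (φ.source ∩ φ ⁻¹' B) := by
    rw [hφ, extChartAt_source]
    exact isOpen_extChartAt_preimage p hBo
  refine ⟨e, he, φ.source ∩ φ ⁻¹' B, hO, ⟨mem_extChartAt_source p, hpB⟩,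
    hBc.of_isClosed_subset isClosed_closure (closure_mono hOB), k, hk, ?_⟩
  intro γ J hJ hγ hcausal harc hmaps s₁ hs₁ s₂ hs₂ hs
  have hsub : Icc s₁ s₂ ⊆ J := hJ.out hs₁ hs₂
  refine ((hLip.comp_curve hγ).mono hsub).mul_sub_le_of_ae_le_deriv hs ?_
  filter_upwards [hcausal, harc] with s h1 h2 hsI hfd
  obtain ⟨hγd, hg1, hg2⟩ := h1 (hsub hsI)
  have h2 := h2 (hsub hsI)
  have hsO := hmaps (hsub hsI)
  have hsrc : γ s ∈ (chartAt E p).source := by simpa [hφ] using hsO.1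
  let v : E := mfderiv 𝓘(ℝ, E) 𝓘(ℝ, E) φ (γ s) (curveVelocity E γ s)
  have hv : chartFrame p (γ s) v = curveVelocity E γ s := chartFrame_mfderiv hsrc _
  have hc : HasDerivAt (fun r ↦ φ (γ r)) v s := by
    have hcm := (mdifferentiableAt_extChartAt (I := 𝓘(ℝ, E)) hsrc).hasMFDerivAt.comp s
      hγd.hasMFDerivAt
    let L : ℝ →L[ℝ] E := (mfderiv 𝓘(ℝ, E) 𝓘(ℝ, E) φ (γ s)).comp (mfderiv 𝓘(ℝ, ℝ) 𝓘(ℝ, E) γ s)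
    have hcf : HasFDerivAt (fun r ↦ φ (γ r)) L s := hasMFDerivAt_iff_hasFDerivAt.1 hcm
    exact hcf.hasDerivAt
  have hev : ∀ᶠ r in 𝓝 s, γ r ∈ φ.source :=
    hγd.continuousAt.eventually_mem ((isOpen_extChartAt_source p).mem_nhds hsO.1)
  have hfd' : HasDerivAt (fun r ↦ τ (φ.symm (φ (γ r)))) (deriv (fun r ↦ τ (γ r)) s) s :=
    hfd.hasDerivAt.congr_of_eventuallyEq (hev.mono fun r hr ↦ by
      simp only [φ.left_inv hr])
  rw [← hv] at h2 hg1 hg2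
  exact le_of_hasDerivAt_comp_of_eventually_le hc (hBo.mem_nhds hsO.2) hK hfd'
    (hgrow _ hsO.2 (γ s) (φ.left_inv hsO.1).symm v h2 hg1 hg2)

end AntiLipschitz

theorem mainTheorem7
    {E : Type*} [NormedAddCommGroup E] [NormedSpace ℝ E] [FiniteDimensional ℝ E]
    {M : Type*} [TopologicalSpace M] [ChartedSpace E M] [IsManifold 𝓘(ℝ, E) ∞ M]
    [T2Space M] [SecondCountableTopology M]
    (h : Bundle.ContMDiffRiemannianMetric 𝓘(ℝ, E) ∞ E fun x : M ↦ TangentSpace 𝓘(ℝ, E) x)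
    (g : SpacetimeMetric E M) (hg : g.IsStablyCausal)
    (τ : M → ℝ) (hτ : g.IsTimeFunction τ)
    (hLip : IsLocallyLipschitzFun E τ)
    (hAnti : g.IsLocallyAntiLipschitz h τ) :
    ∃ g' : SpacetimeMetric E M, g.Prec g' ∧ g'.IsLocallyAntiLipschitz h τ := by
  have : LocallyCompactSpace M := Manifold.locallyCompact_of_finiteDimensional 𝓘(ℝ, E)
  choose e he O hO hpO hOc k hk hkey using fun p ↦ hAnti.exists_nhds_wider hLip p
  -- Asking only that `r` lie below the width of some `O q` containing `x` makes the admissible set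
  -- an interval, hence convex, and `e p / 2` is admissible throughout `O p`.
  obtain ⟨ε, hε⟩ := exists_continuous_forall_mem_convex_of_local_const
    (t := fun x : M ↦ {r : ℝ | 0 < r ∧ ∃ q, x ∈ O q ∧ r < e q})
    (fun x ↦ OrdConnected.convex ⟨fun r hr r' hr' z hz ↦
      ⟨hr.1.trans_le hz.1, let ⟨q, hq, hlt⟩ := hr'.2; ⟨q, hq, hz.2.trans_lt hlt⟩⟩⟩)
    (fun p ↦ ⟨e p / 2, by
      filter_upwards [(hO p).mem_nhds (hpO p)] with x hx
      exact ⟨half_pos (he p), p, hx, half_lt_self (he p)⟩⟩)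
  have hpos : ∀ x, 0 < ε x := fun x ↦ (hε x).1
  refine ⟨g.widen ε ε.continuous hpos, g.prec_widen ε.continuous hpos, fun p ↦ ?_⟩
  -- The index `q` is fixed at the point `p`; by continuity `ε < e q` persists nearby, so a single
  -- local estimate serves the whole neighbourhood.
  obtain ⟨q, hpq, hlt⟩ := (hε p).2
  refine ⟨O q ∩ {x | ε x < e q}, Filter.inter_mem ((hO q).mem_nhds hpq)
    (ε.continuous.continuousAt.eventually (gt_mem_nhds hlt)),
    (hOc q).of_isClosed_subset isClosed_closure (closure_mono inter_subset_left), k q, hk q, ?_⟩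
  intro γ J hγ harc hmaps
  refine hkey q γ J hγ.1 hγ.2.1 ?_ harc fun s hs ↦ (hmaps hs).1
  filter_upwards [hγ.2.2] with s h1 hs
  obtain ⟨hd, -, hv, hvT⟩ := h1 hs
  rw [g.widen_inner] at hv
  refine ⟨hd, ?_, (g.widen_inner_timeField_neg_iff ε.continuous hpos _ _).1 hvT⟩
  -- Causality for the widened metric reads `g(v, v) ≤ ε g(v, T)²`, so this places the velocity in
  -- the cone of width `e q`.
  have hle : ε (γ s) ≤ e q := (hmaps hs).2.le
  have := mul_le_mul_of_nonneg_right hle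
    (sq_nonneg (g.inner (γ s) (curveVelocity E γ s) (g.timeField (γ s))))
  linarith
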